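/- Let $D\ge 2$ and $T=2$, and consider the static panel multinomial choice model in which, at time $t\in[T]$, alternative $d\in[D]$ is chosen iff $x_{dt}'\theta+\zeta_{dt}>x_{d't}'\theta+\zeta_{d't}$ for all $d'\neq d$, where $\zeta_t\in\mathbb R^D$ is the (composite) shock at time $t$. Fix a number $k$ of covariates, covariate values $x=(x_{dt})$ with $x_{dt}\in\mathbb R^{k}$, and a parameter value $\theta\in\mathbb R^{k}$ (all arbitrary), and put $v_{dt}=x_{dt}'\theta$. For $t\in[T]$ and $d\in[D]$ let $\varepsilon_{d,t}=\{\zeta\in\mathbb R^D: v_{dt}+\zeta_d>v_{d't}+\zeta_{d'}\ \forall d'\ne d\}$. The set of patches is $$F=\{(d_1,\dots,d_T)\in[D]^T:\ \varepsilon_{d_1,1}\cap\dots\cap\varepsilon_{d_T,T}\neq\emptyset\},$$ and the set of regions is $\mathcal R=\{f_1\times\dots\times f_T: f_1,\dots,f_T\in F\}$. Let $A$ be the $D^T\times|\mathcal R|$ matrix whose entry in row $(d_1,\dots,d_T)\in[D]^T$ and column $f_1\times\dots\times f_T$ is $1$ if for every $t$ the $t$-th coordinate of $f_t$ is $d_t$,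 and $0$ otherwise. Let $R_S$ be the matrix of the linear system, in the unknown $q\in\mathbb R^{|\mathcal R|}$, $$\sum_{f_1\times\dots\times f_T:\ f_i=f}q_{f_1\times\dots\times f_T}=\sum_{f_1\times\dots\times f_T:\ f_j=f}q_{f_1\times\dots\times f_T}\qquad(f\in F,\ i,j\in[T])$$ (stationarity), and let $R_E$ be the matrix of the linear system $q_{f_1\times\dots\times f_T}=q_{f_{\pi(1)}\times\dots\times f_{\pi(T)}}$, for all $f_1\times\dots\times f_T\in\mathcal R$ and all permutations $\pi$ of $[T]$ (exchangeability). For $r\in\{E,S\}$, the dual discrete choice polytope is $$\mathcal Q_r=\{y\in\mathbb R^{D^T}:\ \exists z\ \text{ such that } A^{T}y\le R_r^{T}z,\ \ \|y\|_\infty\le 1\}$$ (here $A^T$ and $R_r^T$ are transposes, and the inequality is componentwise). A point $y\in\mathcal Q_r$ is undominated if there is no $y'\in\mathcal Q_r$ with $y'\ne y$ and $y'\ge y$ componentwise. The rank of $y$ is the sum of its components. **Theorem.** For both $r=E$ and $r=S$: 1. $\mathcal Q_r$ is integral: every extreme point of $\mathcal Q_r$ lies in $\{0,\pm1\}^{D^2}$.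 2. The rank attains a maximum on $\mathcal Q_r$, and every undominated extreme point of $\mathcal Q_r$ has rank equal to this maximum (in particular, all undominated extreme points have the same rank). -/

import Mathlib

open scoped Matrix

namespace StaticChoice

/-- The deterministic parts of the utilities, `v t d = x_{dt}' θ`: here `x t d` is the covariate
vector of alternative `d` at time `t`, and `θ` is the index parameter. -/
def indexValues {T D k : ℕ} (x : Fin T → Fin D → (Fin k → ℝ)) (θ : Fin k → ℝ) :
    Fin T → Fin D → ℝ :=
  fun t d => x t d ⬝ᵥ θ

/-- The set of (composite) shocks in `ℝ^D` for which alternative `d` is chosen at time `t`. -/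
def choiceRegion {T D : ℕ} (v : Fin T → Fin D → ℝ) (t : Fin T) (d : Fin D) : Set (Fin D → ℝ) :=
  {ζ | ∀ d', d' ≠ d → v t d' + ζ d' < v t d + ζ d}

/-- The set `F` of patches: the choice sequences `(d_1, …, d_T)` for which some shock
`ζ ∈ ℝ^D` makes the agent choose `d_t` at time `t`, simultaneously for all `t`. -/
def patches {T D : ℕ} (v : Fin T → Fin D → ℝ) : Set (Fin T → Fin D) :=
  {f | (⋂ t, choiceRegion v t (f t)).Nonempty}

noncomputable instance {T D : ℕ} (v : Fin T → Fin D → ℝ) : Fintype (patches v) :=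
  Fintype.ofFinite _

/-- The rectangular regions `f_1 × ⋯ × f_T`, with all `f_t` in `F`. -/
abbrev Region {T D : ℕ} (v : Fin T → Fin D → ℝ) : Type :=
  Fin T → patches v

/-- The matrix `A`: the entry in row `d ∈ [D]^T` and column `f_1 × ⋯ × f_T` is `1` if for every
`t` the patch `f_t` induces the choice `d_t` at time `t`, and is `0` otherwise. -/
def matA {T D : ℕ} (v : Fin T → Fin D → ℝ) : Matrix (Fin T → Fin D) (Region v) ℝ :=
  Matrix.of fun d R => if ∀ t, (R t : Fin T → Fin D) t = d t then 1 else 0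

/-- The matrix `R_S` of the stationarity restriction. The row `(f, i, j)` of `R_S q = 0` says
that the total mass of the regions with `i`-th patch `f` equals the total mass of the regions with
`j`-th patch `f`. -/
def matRS {T D : ℕ} (v : Fin T → Fin D → ℝ) :
    Matrix (patches v × Fin T × Fin T) (Region v) ℝ :=
  Matrix.of fun r R =>
    (if R r.2.1 = r.1 then 1 else 0) - (if R r.2.2 = r.1 then 1 else 0)

/-- The matrix `R_E` of the exchangeability restriction. The row `(R₀, π)` of `R_E q = 0`, with
`R₀ = f_1 × ⋯ × f_T`, says that `q` has the same entries at `f_1 × ⋯ × f_T` and at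
`f_{π(1)} × ⋯ × f_{π(T)}`. -/
def matRE {T D : ℕ} (v : Fin T → Fin D → ℝ) :
    Matrix (Region v × Equiv.Perm (Fin T)) (Region v) ℝ :=
  Matrix.of fun r R =>
    (if R = r.1 then 1 else 0) - (if R = fun t => r.1 (r.2 t) then 1 else 0)

/-- The polytope `{y | ∃ z, Aᵀ y ≤ Rᵀ z, ‖y‖_∞ ≤ 1}` of matrices `A` and `R`
(the norm of a function on a finite type is the sup norm). -/
def dualPolytope {m n l : Type*} [Fintype m] [Fintype l]
    (A : Matrix m n ℝ) (R : Matrix l n ℝ) : Set (m → ℝ) :=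
  {y | (∃ z : l → ℝ, Aᵀ *ᵥ y ≤ Rᵀ *ᵥ z) ∧ ‖y‖ ≤ 1}

/-- The dual discrete choice polytope at `(x, θ)` under stationarity. -/
def ddcpS {T D k : ℕ} (x : Fin T → Fin D → (Fin k → ℝ)) (θ : Fin k → ℝ) :
    Set ((Fin T → Fin D) → ℝ) :=
  dualPolytope (matA (indexValues x θ)) (matRS (indexValues x θ))

/-- The dual discrete choice polytope at `(x, θ)` under exchangeability. -/
def ddcpE {T D k : ℕ} (x : Fin T → Fin D → (Fin k → ℝ)) (θ : Fin k → ℝ) :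
    Set ((Fin T → Fin D) → ℝ) :=
  dualPolytope (matA (indexValues x θ)) (matRE (indexValues x θ))

/-- `y ∈ C` is undominated in `C` if no `y' ∈ C` other than `y` is componentwise `≥ y`. -/
def IsUndominated {ι : Type*} (C : Set (ι → ℝ)) (y : ι → ℝ) : Prop :=
  y ∈ C ∧ ¬ ∃ y' ∈ C, y' ≠ y ∧ y ≤ y'

/-- The rank of a vector: the sum of its components. -/
def rank {ι : Type*} [Fintype ι] (y : ι → ℝ) : ℝ := ∑ i, y i

end StaticChoice

namespace StaticChoice

/-! With `T = 2`, being a patch is a reflexive and transitive relation on alternatives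
(`mem_patches_iff`, `patches_trans`), and eliminating `z` describes both polytopes explicitly. Under
exchangeability the constraints are `y ![a, d] + y ![c, b] ≤ 0` for patches `(a, b)`, `(c, d)`;
under stationarity they say `y ![a, b] ≤ p a - q b` for potentials with `p ≤ q` along patches.

Integrality comes from a perturbation that keeps the tight constraints tight: an odd function of the
coordinates for `E`, a shift of one class of potentials modulo `ℤ` for `S`. At an extreme point it
must vanish.

For the rank, diagonal patches give `y ![a, b] + y ![b, a] ≤ 0`, so the maximum is `0`, attained at
the origin. Transitivity makes every undominated point, extreme or not, antisymmetric, hence of rank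
`0`. -/

variable {D : ℕ}

/-! ### Patches as a preorder -/

/-- With two periods, `(a, b)` is a patch iff `a = b` or the utility index of `a` falls strictly
more between the periods than the one of `b`. -/
theorem mem_patches_iff (v : Fin 2 → Fin D → ℝ) (f : Fin 2 → Fin D) :
    f ∈ patches v ↔ f 0 = f 1 ∨ v 0 (f 1) - v 1 (f 1) < v 0 (f 0) - v 1 (f 0) := by
  simp only [patches, Set.mem_ofPred_eq, Set.Nonempty, Set.mem_iInter, Fin.forall_fin_two,
    choiceRegion]
  constructor
  · rintro ⟨ζ, h0, h1⟩
    by_cases h : f 0 = f 1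
    · exact Or.inl h
    · have e0 := h0 (f 1) (Ne.symm h)
      have e1 := h1 (f 0) h
      right
      linarith
  · intro h
    obtain ⟨M, hM⟩ : ∃ M, ∀ d, v 0 d ≤ M := by
      obtain ⟨M, hM⟩ := (Set.finite_range (v 0)).bddAbove
      exact ⟨M, fun d => hM ⟨d, rfl⟩⟩
    obtain ⟨N, hN⟩ : ∃ N, ∀ d, v 1 d ≤ N := by
      obtain ⟨N, hN⟩ := (Set.finite_range (v 1)).bddAbove
      exact ⟨N, fun d => hN ⟨d, rfl⟩⟩
    generalize f 0 = a at *
    generalize f 1 = b at *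
    set δ := (v 0 a - v 1 a) - (v 0 b - v 1 b) with hδ
    have hδ0 : 0 ≤ δ := by
      rcases h with h | h
      · simp [hδ, h]
      · linarith
    set K := |M| + |N| + |v 0 a - v 1 a| + δ + 1 with hK
    have k1 := le_abs_self M
    have k2 := le_abs_self N
    have k3 := le_abs_self (v 0 a - v 1 a)
    have k4 := abs_nonneg M
    have k5 := abs_nonneg N
    have k6 := abs_nonneg (v 0 a - v 1 a)
    -- If `a ≠ b`, `a` beats `b` by `δ / 2` at time 0 and loses by `δ / 2` at time 1; `K` is large
    -- enough to keep every other alternative below both.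
    refine ⟨fun d => if d = a then -v 0 a else if d = b then -v 0 b - δ / 2 else -K, ?_, ?_⟩
    · intro d hd
      have := hM d
      by_cases hb : d = b
      · subst hb
        have : v 0 d - v 1 d < v 0 a - v 1 a := h.resolve_left (Ne.symm hd)
        simp only [hd, if_true, if_false]
        linarith
      · simp only [hd, hb, if_true, if_false]
        linarith
    · intro d hd
      have := hN d
      by_cases hba : b = a
      · have hda : d ≠ a := hba ▸ hd
        have hδ' : δ = 0 := by simp [hδ, hba]
        simp only [hda, hba, if_true, if_false]
        linarith
      · have hlt := h.resolve_left (Ne.symm hba)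
        by_cases hda : d = a
        · subst hda
          simp only [hba, if_true, if_false]
          linarith
        · simp only [hd, hda, hba, if_true, if_false]
          linarith

theorem diag_mem_patches (v : Fin 2 → Fin D → ℝ) (a : Fin D) : ![a, a] ∈ patches v :=
  (mem_patches_iff v _).2 (Or.inl rfl)

theorem patches_trans {v : Fin 2 → Fin D → ℝ} {a b c : Fin D}
    (hab : ![a, b] ∈ patches v) (hbc : ![b, c] ∈ patches v) : ![a, c] ∈ patches v := by
  rw [mem_patches_iff] at *
  simp only [Matrix.cons_val_zero, Matrix.cons_val_one] at *
  rcases hab with rfl | hab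
  · exact hbc
  · rcases hbc with rfl | hbc
    · exact Or.inr hab
    · exact Or.inr (hbc.trans hab)

/-! ### The transposed systems -/

theorem matA_transpose_mulVec {T : ℕ} (v : Fin T → Fin D → ℝ) (y : (Fin T → Fin D) → ℝ)
    (R : Region v) : ((matA v)ᵀ *ᵥ y) R = y fun t => (R t : Fin T → Fin D) t := by
  simp only [Matrix.mulVec, dotProduct, Matrix.transpose_apply, matA, Matrix.of_apply, ite_mul,
    one_mul, zero_mul]
  rw [Finset.sum_eq_single fun t => (R t : Fin T → Fin D) t]
  · simp
  · intro d _ hd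
    rw [if_neg]
    exact fun h => hd (funext fun t => (h t).symm)
  · simp

/-- Identity rows vanish, so only the swap contributes, and the result is antisymmetric under
exchanging the two patches. -/
theorem matRE_transpose_mulVec (v : Fin 2 → Fin D → ℝ)
    (z : Region v × Equiv.Perm (Fin 2) → ℝ) (R : Region v) :
    ((matRE v)ᵀ *ᵥ z) R =
      z (R, Equiv.swap 0 1) - z (fun t => R (Equiv.swap 0 1 t), Equiv.swap 0 1) := by
  have hperm : (Finset.univ : Finset (Equiv.Perm (Fin 2))) = {1, Equiv.swap 0 1} := by decide
  have hne : (1 : Equiv.Perm (Fin 2)) ≠ Equiv.swap 0 1 := by decide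
  have hswap : ∀ R' : Region v,
      (R = fun t => R' (Equiv.swap 0 1 t)) ↔ (fun t => R (Equiv.swap 0 1 t)) = R' := by
    intro R'
    constructor
    · rintro rfl
      funext t
      simp
    · rintro rfl
      funext t
      simp
  have h1 : ∀ R', matRE v (R', 1) R = 0 := fun R' => by
    rw [matRE, Matrix.of_apply, sub_eq_zero]
    exact if_congr Iff.rfl rfl rfl
  have h2 : ∀ R', matRE v (R', Equiv.swap 0 1) R =
      (if R = R' then 1 else 0) - if (fun t => R (Equiv.swap 0 1 t)) = R' then 1 else 0 :=
    fun R' => by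
      rw [matRE, Matrix.of_apply]
      congr 1
      exact if_congr (hswap R') rfl rfl
  simp only [Matrix.mulVec, dotProduct, Matrix.transpose_apply, Fintype.sum_prod_type, hperm,
    Finset.sum_pair hne, h1, h2, zero_mul, zero_add, sub_mul, Finset.sum_sub_distrib, ite_mul,
    one_mul, Finset.sum_ite_eq, Finset.mem_univ, if_true]

theorem matRS_transpose_mulVec (v : Fin 2 → Fin D → ℝ)
    (z : patches v × Fin 2 × Fin 2 → ℝ) (R : Region v) :
    ((matRS v)ᵀ *ᵥ z) R =
      (z (R 0, 0, 1) - z (R 0, 1, 0)) - (z (R 1, 0, 1) - z (R 1, 1, 0)) := by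
  simp only [Matrix.mulVec, dotProduct, Matrix.transpose_apply, matRS, Matrix.of_apply,
    Fintype.sum_prod_type, Fin.sum_univ_two, zero_mul, sub_mul,
    Finset.sum_add_distrib, Finset.sum_sub_distrib, ite_mul, one_mul]
  simp
  ring

theorem norm_le_one_iff {ι : Type*} [Fintype ι] (y : ι → ℝ) : ‖y‖ ≤ 1 ↔ ∀ d, |y d| ≤ 1 := by
  rw [pi_norm_le_iff_of_nonneg zero_le_one]
  rfl

theorem region_choice (v : Fin 2 → Fin D → ℝ) (R : Region v) :
    (fun t => (R t : Fin 2 → Fin D) t) =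
      ![(R 0 : Fin 2 → Fin D) 0, (R 1 : Fin 2 → Fin D) 1] := by
  funext t
  fin_cases t <;> rfl

theorem eta_pair {α : Type*} (f : Fin 2 → α) : ![f 0, f 1] = f := by
  funext t
  fin_cases t <;> rfl

/-! ### Elimination of the multipliers -/

/-- The exchangeability polytope is cut out by constraints on pairs of coordinates. -/
theorem mem_dualPolytope_matRE_iff (v : Fin 2 → Fin D → ℝ) (y : (Fin 2 → Fin D) → ℝ) :
    y ∈ dualPolytope (matA v) (matRE v) ↔
      (∀ a b c d, ![a, b] ∈ patches v → ![c, d] ∈ patches v → y ![a, d] + y ![c, b] ≤ 0) ∧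
        ∀ e, |y e| ≤ 1 := by
  simp only [dualPolytope, Set.mem_ofPred_eq, norm_le_one_iff, Pi.le_def, matA_transpose_mulVec,
    matRE_transpose_mulVec, region_choice]
  refine and_congr_left fun _ => ⟨?_, fun h => ?_⟩
  · rintro ⟨z, hz⟩ a b c d hab hcd
    have h1 := hz ![⟨_, hab⟩, ⟨_, hcd⟩]
    -- Adding the inequalities at a region and at its swap cancels `z`.
    have h2 := hz fun t => (![⟨_, hab⟩, ⟨_, hcd⟩] : Region v) (Equiv.swap 0 1 t)
    simp at h1 h2
    linarith
  -- With half of `Aᵀ y` as multiplier, the inequality at `R` becomes the pair constraint for `R`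
  -- and its swap.
  · refine ⟨fun r => y ![(r.1 0 : Fin 2 → Fin D) 0, (r.1 1 : Fin 2 → Fin D) 1] / 2, fun R => ?_⟩
    have := h _ _ _ _ ((eta_pair (R 0 : Fin 2 → Fin D)).symm ▸ (R 0).2)
      ((eta_pair (R 1 : Fin 2 → Fin D)).symm ▸ (R 1).2)
    simp only [Equiv.swap_apply_left, Equiv.swap_apply_right]
    linarith

/-- The stationarity polytope in terms of two potentials on the alternatives. -/
theorem mem_dualPolytope_matRS_iff (v : Fin 2 → Fin D → ℝ) (y : (Fin 2 → Fin D) → ℝ) :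
    y ∈ dualPolytope (matA v) (matRS v) ↔
      (∃ p q : Fin D → ℝ, (∀ a b, ![a, b] ∈ patches v → p a ≤ q b) ∧
        ∀ a b, y ![a, b] ≤ p a - q b) ∧ ∀ e, |y e| ≤ 1 := by
  simp only [dualPolytope, Set.mem_ofPred_eq, norm_le_one_iff, Pi.le_def, matA_transpose_mulVec,
    matRS_transpose_mulVec, region_choice]
  refine and_congr_left fun _ => ⟨?_, ?_⟩
  · rintro ⟨z, hz⟩
    obtain ⟨w, hw⟩ : ∃ w : patches v → ℝ, ∀ f, w f = z (f, 0, 1) - z (f, 1, 0) :=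
      ⟨_, fun _ => rfl⟩
    -- The constraint for the choice `(a, b)` is strongest when `w` is least among patches starting
    -- at `a` and greatest among those ending at `b`; these extremes are `p` and `q`.
    have hmin : ∀ a, ∃ f : patches v, f.1 0 = a ∧ ∀ g : patches v, g.1 0 = a → w f ≤ w g := by
      intro a
      obtain ⟨f, hf, hle⟩ := Set.exists_min_image {f : patches v | f.1 0 = a} w (Set.toFinite _)
        ⟨⟨_, diag_mem_patches v a⟩, rfl⟩
      exact ⟨f, hf, hle⟩
    have hmax : ∀ b, ∃ f : patches v, f.1 1 = b ∧ ∀ g : patches v, g.1 1 = b → w g ≤ w f := by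
      intro b
      obtain ⟨f, hf, hle⟩ := Set.exists_max_image {f : patches v | f.1 1 = b} w (Set.toFinite _)
        ⟨⟨_, diag_mem_patches v b⟩, rfl⟩
      exact ⟨f, hf, hle⟩
    choose F hF hFle using hmin
    choose G hG hGle using hmax
    refine ⟨fun a => w (F a), fun b => w (G b), fun a b hab => ?_, fun a b => ?_⟩
    · exact (hFle a ⟨_, hab⟩ rfl).trans (hGle b ⟨_, hab⟩ rfl)
    · have := hz ![F a, G b]
      simpa [hF, hG, hw] using this
  · rintro ⟨p, q, hpq, hy⟩
    -- The multiplier `p (f 0)` suffices, since `p ≤ q` along the second patch.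
    refine ⟨fun r => if r.2.1 = 0 ∧ r.2.2 = 1 then p ((r.1 : Fin 2 → Fin D) 0) else 0,
      fun R => ?_⟩
    have h1 := hy ((R 0 : Fin 2 → Fin D) 0) ((R 1 : Fin 2 → Fin D) 1)
    have h2 := hpq _ _ ((eta_pair (R 1 : Fin 2 → Fin D)).symm ▸ (R 1).2)
    simp
    linarith

/-! ### Tools for extreme points and rank -/

/-- A point of a set that can be moved a little in both directions along `u` is not extreme
unless `u` vanishes. -/
theorem eq_zero_of_mem_extremePoints {E : Type*} [AddCommGroup E] [Module ℝ E] {Q : Set E}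
    {y u : E} (hy : y ∈ Q.extremePoints ℝ) (h1 : y + u ∈ Q) (h2 : y - u ∈ Q) : u = 0 := by
  have hseg : y ∈ openSegment ℝ (y + u) (y - u) := by
    refine ⟨1 / 2, 1 / 2, by norm_num, by norm_num, by norm_num, ?_⟩
    module
  simpa using hy.2 h1 h2 hseg

/-- Pairing each choice sequence with its reversal counts the rank twice. -/
theorem rank_nonpos_of_add_nonpos {y : (Fin 2 → Fin D) → ℝ}
    (h : ∀ a b, y ![a, b] + y ![b, a] ≤ 0) : rank y ≤ 0 := by
  have e : ∑ f : Fin 2 → Fin D, y ![f 1, f 0] = ∑ f, y f := by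
    refine Fintype.sum_equiv (Equiv.arrowCongr (Equiv.swap 0 1) (Equiv.refl _)) _ _ fun f => ?_
    congr 1
    funext t
    fin_cases t <;> simp
  have : ∑ f : Fin 2 → Fin D, (y f + y ![f 1, f 0]) ≤ 0 :=
    Finset.sum_nonpos fun f _ => by simpa only [eta_pair] using h (f 0) (f 1)
  rw [Finset.sum_add_distrib, e] at this
  unfold rank
  linarith

theorem rank_eq_zero_of_add_eq_zero {y : (Fin 2 → Fin D) → ℝ}
    (h : ∀ a b, y ![a, b] + y ![b, a] = 0) : rank y = 0 := by
  refine le_antisymm (rank_nonpos_of_add_nonpos fun a b => (h a b).le) ?_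
  have := rank_nonpos_of_add_nonpos (y := -y) fun a b => by
    have := h a b
    simp only [Pi.neg_apply]
    linarith
  simpa [rank] using this

/-- A uniform radius below finitely many positive numbers. -/
theorem exists_pos_le_of_finite {ι : Type*} [Finite ι] (s : ι → ℝ) :
    ∃ ε > 0, ∀ i, 0 < s i → ε ≤ s i := by
  obtain ⟨ε, hε, h⟩ : ∃ ε > 0, ∀ i, ε ≤ if 0 < s i then s i else 1 := by
    rcases isEmpty_or_nonempty ι with hι | hι
    · exact ⟨1, one_pos, fun i => hι.elim i⟩
    · obtain ⟨i, hi⟩ := Finite.exists_min fun i => if 0 < s i then s i else 1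
      refine ⟨_, ?_, hi⟩
      split_ifs with h
      · exact h
      · exact one_pos
  exact ⟨ε, hε, fun i hi => by simpa [hi] using h i⟩

/-! ### Integrality -/

/-- A tight pair constraint makes its two coordinates opposite, so moving each coordinate by an odd
function of its value preserves it. Extremality then leaves no coordinate off `0` and `±1`. -/
theorem integral_of_mem_extremePoints_matRE {v : Fin 2 → Fin D → ℝ} {y : (Fin 2 → Fin D) → ℝ}
    (hy : y ∈ (dualPolytope (matA v) (matRE v)).extremePoints ℝ) (e : Fin 2 → Fin D) :
    y e = 0 ∨ y e = 1 ∨ y e = -1 := by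
  by_contra hne
  obtain ⟨hc, hb⟩ := (mem_dualPolytope_matRE_iff v y).1 hy.1
  -- Move the fractional coordinates away from zero, or towards it.
  let σ : ℝ → ℝ := fun t => if |t| = 1 then 0 else SignType.sign t
  have hσ : ∀ t, |σ t| ≤ 1 := by
    intro t
    simp only [σ]
    split_ifs
    · simp
    · rcases lt_trichotomy t 0 with h | h | h <;> simp [h]
  have hσneg : ∀ t, σ (-t) = -σ t := by
    intro t
    simp only [σ, abs_neg]
    split_ifs
    · simp
    · simp [Left.sign_neg]
  obtain ⟨ε₁, hε₁, h₁⟩ := exists_pos_le_of_finite fun i : Fin 2 → Fin D => 1 - |y i|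
  -- The slack is halved because both coordinates of a pair may move.
  obtain ⟨ε₂, hε₂, h₂⟩ := exists_pos_le_of_finite
    fun i : (Fin 2 → Fin D) × (Fin 2 → Fin D) => (-(y i.1 + y i.2)) / 2
  have key : ∀ s : ℝ, |s| ≤ min ε₁ ε₂ →
      (fun i => y i + s * σ (y i)) ∈ dualPolytope (matA v) (matRE v) := by
    intro s hs
    have hs1 : |s| ≤ ε₁ := hs.trans (min_le_left _ _)
    have hs2 : |s| ≤ ε₂ := hs.trans (min_le_right _ _)
    have hbd : ∀ t, |s * σ t| ≤ |s| := fun t => by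
      rw [abs_mul]
      exact mul_le_of_le_one_right (abs_nonneg _) (hσ t)
    refine (mem_dualPolytope_matRE_iff v _).2 ⟨fun a b c d hab hcd => ?_, fun i => ?_⟩
    · rcases (hc a b c d hab hcd).lt_or_eq with hlt | heq
      · have := h₂ (![a, d], ![c, b]) (by simp only; linarith)
        simp only at this
        have e1 := (abs_le.1 (hbd (y ![a, d]))).2
        have e2 := (abs_le.1 (hbd (y ![c, b]))).2
        linarith
      · have : y ![c, b] = -y ![a, d] := by linarith
        rw [this, hσneg]
        linarith
    · by_cases h : |y i| = 1
      · simp [σ, h]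
      · have := h₁ i (sub_pos.2 (lt_of_le_of_ne (hb i) h))
        have e1 := abs_add_le (y i) (s * σ (y i))
        have e2 := hbd (y i)
        linarith
  have hm : 0 < min ε₁ ε₂ := lt_min hε₁ hε₂
  have hu := eq_zero_of_mem_extremePoints hy (u := fun i => min ε₁ ε₂ * σ (y i))
    (key _ (abs_of_pos hm).le) (by
      have := key (-min ε₁ ε₂) (by rw [abs_neg, abs_of_pos hm])
      convert this using 1
      funext i
      simp only [Pi.sub_apply]
      ring)
  have hu' := (mul_eq_zero.1 (congrFun hu e)).resolve_left hm.ne'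
  apply hne
  simp only [σ] at hu'
  split_ifs at hu' with h
  · exact Or.inr (eq_or_eq_neg_of_abs_eq h)
  · left
    rcases lt_trichotomy (y e) 0 with h | h | h
    · simp [h] at hu'
    · exact h
    · simp [h] at hu'

/-- Fractional coordinates equal `p a - q b`, so they follow the potentials. Shifting all potentials
congruent modulo `ℤ` to `p (e 0)` respects every equality `p a = q b` and every integral tight
bound, yet moves a fractional `y e`. -/
theorem integral_of_mem_extremePoints_matRS {v : Fin 2 → Fin D → ℝ} {y : (Fin 2 → Fin D) → ℝ}
    (hy : y ∈ (dualPolytope (matA v) (matRS v)).extremePoints ℝ) (e : Fin 2 → Fin D) :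
    y e = 0 ∨ y e = 1 ∨ y e = -1 := by
  obtain ⟨⟨p, q, hpq, hle⟩, hb⟩ := (mem_dualPolytope_matRS_iff v y).1 hy.1
  suffices hint : Int.fract (y e) = 0 by
    obtain ⟨n, hn⟩ : ∃ n : ℤ, (n : ℝ) = y e := by
      simpa [Int.fract_eq_zero_iff] using hint
    have h := abs_le.1 (hb e)
    rw [← hn] at h ⊢
    have h1 : -1 ≤ n := by exact_mod_cast h.1
    have h2 : n ≤ 1 := by exact_mod_cast h.2
    interval_cases n <;> simp
  by_contra hfr
  -- Shift the potentials in the fractional class of `p (e 0)`, and the fractional coordinates.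
  let χ : ℝ → ℝ := fun t => if Int.fract t = Int.fract (p (e 0)) then 1 else 0
  have hχ0 : ∀ t, 0 ≤ χ t := fun t => by simp only [χ]; split_ifs <;> norm_num
  have hχ1 : ∀ t, χ t ≤ 1 := fun t => by simp only [χ]; split_ifs <;> norm_num
  have hχ : ∀ s t, Int.fract (s - t) = 0 → χ s = χ t := by
    intro s t h
    obtain ⟨n, hn⟩ : ∃ n : ℤ, (n : ℝ) = s - t := by
      simpa [Int.fract_eq_zero_iff] using h
    have : s = t + n := by linarith
    simp only [χ, this, Int.fract_add_intCast]
  obtain ⟨ε₁, hε₁, h₁⟩ := exists_pos_le_of_finite fun i : Fin 2 → Fin D => 1 - |y i|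
  obtain ⟨ε₂, hε₂, h₂⟩ := exists_pos_le_of_finite fun i : Fin D × Fin D => q i.2 - p i.1
  obtain ⟨ε₃, hε₃, h₃⟩ := exists_pos_le_of_finite
    fun i : Fin D × Fin D => p i.1 - q i.2 - y ![i.1, i.2]
  set ε := min ε₁ (min ε₂ ε₃) with hε
  have hε0 : 0 < ε := lt_min hε₁ (lt_min hε₂ hε₃)
  have hlt1 : ∀ i, Int.fract (y i) ≠ 0 → |y i| < 1 := by
    intro i hi
    refine lt_of_le_of_ne (hb i) fun h => hi ?_
    rcases eq_or_eq_neg_of_abs_eq h with h | h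
    · rw [h]; simp
    · rw [h, show (-1 : ℝ) = ((-1 : ℤ) : ℝ) by norm_num, Int.fract_intCast]
  -- A fractional coordinate is tight, since it could otherwise be moved alone.
  have htight : ∀ a b, Int.fract (y ![a, b]) ≠ 0 → y ![a, b] = p a - q b := by
    intro a b hab
    by_contra hne
    have hlt : y ![a, b] < p a - q b := lt_of_le_of_ne (hle a b) hne
    have g1 := h₁ ![a, b] (sub_pos.2 (hlt1 _ hab))
    have g3 := h₃ (a, b) (by simp only; linarith)
    simp only at g1 g3
    have key : ∀ s : ℝ, |s| ≤ ε →
        (fun i => y i + if i = ![a, b] then s else 0) ∈ dualPolytope (matA v) (matRS v) := by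
      intro s hs
      have hs1 : |s| ≤ ε₁ := hs.trans (min_le_left _ _)
      have hs3 : |s| ≤ ε₃ := hs.trans ((min_le_right _ _).trans (min_le_right _ _))
      refine (mem_dualPolytope_matRS_iff v _).2 ⟨⟨p, q, hpq, fun c d => ?_⟩, fun i => ?_⟩
      · by_cases hi : ![c, d] = ![a, b]
        · have hc : c = a := congrFun hi 0
          have hd : d = b := congrFun hi 1
          subst hc hd
          have := le_abs_self s
          simp only [if_true]
          linarith
        · simpa [hi] using hle c d
      · by_cases hi : i = ![a, b]
        · subst hi
          have := abs_add_le (y ![a, b]) s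
          simp only [if_true]
          linarith
        · simpa [hi] using hb i
    have hu := eq_zero_of_mem_extremePoints hy (u := fun i => if i = ![a, b] then ε else 0)
      (key _ (abs_of_pos hε0).le) (by
        have := key (-ε) (by rw [abs_neg, abs_of_pos hε0])
        convert this using 1
        funext i
        simp only [Pi.sub_apply]
        split_ifs <;> ring)
    have := congrFun hu ![a, b]
    simp only [if_true, Pi.zero_apply] at this
    exact hε0.ne' this
  let u : (Fin 2 → Fin D) → ℝ := fun i =>
    if Int.fract (y i) = 0 then 0 else χ (p (i 0)) - χ (q (i 1))
  have key : ∀ s : ℝ, |s| ≤ ε →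
      (fun i => y i + s * u i) ∈ dualPolytope (matA v) (matRS v) := by
    intro s hs
    have hs1 : |s| ≤ ε₁ := hs.trans (min_le_left _ _)
    have hs2 : |s| ≤ ε₂ := hs.trans ((min_le_right _ _).trans (min_le_left _ _))
    have hs3 : |s| ≤ ε₃ := hs.trans ((min_le_right _ _).trans (min_le_right _ _))
    have hbd : ∀ r t, |s * (χ r - χ t)| ≤ |s| := fun r t => by
      rw [abs_mul]
      refine mul_le_of_le_one_right (abs_nonneg _) (abs_le.2 ⟨?_, ?_⟩) <;>
        linarith [hχ0 r, hχ1 r, hχ0 t, hχ1 t]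
    refine (mem_dualPolytope_matRS_iff v _).2
      ⟨⟨fun a => p a + s * χ (p a), fun b => q b + s * χ (q b), fun a b hab => ?_,
        fun a b => ?_⟩, fun i => ?_⟩
    · rcases (hpq a b hab).lt_or_eq with hlt | heq
      · have g := h₂ (a, b) (by simp only; linarith)
        have g' := (abs_le.1 (hbd (p a) (q b))).2
        simp only at g ⊢
        linarith
      · simp only [heq, le_refl]
    · by_cases hi : Int.fract (y ![a, b]) = 0
      · simp only [u, hi, if_true, mul_zero, add_zero]
        rcases (hle a b).lt_or_eq with hlt | heq
        · have g := h₃ (a, b) (by simp only; linarith)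
          have g' := (abs_le.1 (hbd (p a) (q b))).1
          simp only at g
          linarith
        -- An integral tight coordinate has `p a` and `q b` in the same class, so its bound does not
        -- move.
        · rw [heq] at hi
          rw [hχ _ _ hi]
          linarith
      · have := htight a b hi
        simp only [u, hi, if_false, Matrix.cons_val_zero, Matrix.cons_val_one]
        linarith
    · by_cases hi : Int.fract (y i) = 0
      · simpa [u, hi] using hb i
      · have g := h₁ i (sub_pos.2 (hlt1 _ hi))
        have g1 := abs_add_le (y i) (s * (χ (p (i 0)) - χ (q (i 1))))
        have g2 := hbd (p (i 0)) (q (i 1))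
        simp only [u, hi, if_false] at g ⊢
        linarith
  have hu := eq_zero_of_mem_extremePoints hy (u := fun i => ε * u i)
    (key _ (abs_of_pos hε0).le) (by
      have := key (-ε) (by rw [abs_neg, abs_of_pos hε0])
      convert this using 1
      funext i
      simp only [Pi.sub_apply]
      ring)
  have hu' := (mul_eq_zero.1 (congrFun hu e)).resolve_left hε0.ne'
  have ht := htight (e 0) (e 1) (by rwa [eta_pair])
  rw [eta_pair] at ht
  -- As `y e = p (e 0) - q (e 1)` is fractional, `q (e 1)` lies outside the shifted class and `u e =
  -- 1`.
  have hq : Int.fract (q (e 1)) ≠ Int.fract (p (e 0)) := by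
    intro h
    obtain ⟨n, hn⟩ := Int.fract_eq_fract.1 h
    apply hfr
    rw [ht, show p (e 0) - q (e 1) = ((-n : ℤ) : ℝ) by push_cast; linarith, Int.fract_intCast]
  simp [u, χ, hfr, hq] at hu'

/-! ### Rank of undominated points -/

theorem add_swap_nonpos_of_mem_matRE {v : Fin 2 → Fin D → ℝ} {y : (Fin 2 → Fin D) → ℝ}
    (hy : y ∈ dualPolytope (matA v) (matRE v)) (a b : Fin D) : y ![a, b] + y ![b, a] ≤ 0 :=
  ((mem_dualPolytope_matRE_iff v y).1 hy).1 a a b b (diag_mem_patches v a) (diag_mem_patches v b)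

theorem add_swap_nonpos_of_mem_matRS {v : Fin 2 → Fin D → ℝ} {y : (Fin 2 → Fin D) → ℝ}
    (hy : y ∈ dualPolytope (matA v) (matRS v)) (a b : Fin D) : y ![a, b] + y ![b, a] ≤ 0 := by
  obtain ⟨⟨p, q, hpq, hle⟩, -⟩ := (mem_dualPolytope_matRS_iff v y).1 hy
  linarith [hle a b, hle b a, hpq a a (diag_mem_patches v a), hpq b b (diag_mem_patches v b)]

/-- In the exchangeability polytope, a coordinate below `1` of an undominated point lies in a
tight pair constraint. -/
theorem exists_tight_of_isUndominated_matRE {v : Fin 2 → Fin D → ℝ} {y : (Fin 2 → Fin D) → ℝ}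
    (hy : IsUndominated (dualPolytope (matA v) (matRE v)) y) (a b : Fin D)
    (hlt : y ![a, b] < 1) :
    ∃ c d, ![a, d] ∈ patches v ∧ ![c, b] ∈ patches v ∧ y ![c, d] = -y ![a, b] := by
  by_contra! hno
  obtain ⟨hc, hb⟩ := (mem_dualPolytope_matRE_iff v y).1 hy.1
  obtain ⟨ε, hε, h⟩ := exists_pos_le_of_finite
    fun i : Fin D × Fin D => (-(y ![a, b] + y ![i.1, i.2])) / 2
  set δ := min ε (1 - y ![a, b]) with hδ
  have hδ0 : 0 < δ := lt_min hε (sub_pos.2 hlt)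
  have hδ1 : δ ≤ ε := min_le_left _ _
  have hδ2 : δ ≤ 1 - y ![a, b] := min_le_right _ _
  -- The factor 2 covers the pair in which `![a, b]` occurs twice.
  have hslack : ∀ c d, ![a, d] ∈ patches v → ![c, b] ∈ patches v →
      y ![a, b] + y ![c, d] + 2 * δ ≤ 0 := by
    intro c d had hcb
    have h1 := hc a d c b had hcb
    have h2 : y ![a, b] + y ![c, d] < 0 :=
      lt_of_le_of_ne h1 fun h => hno c d had hcb (by linarith)
    have h3 := h (c, d) (by simp only; linarith)
    simp only at h3
    linarith
  refine hy.2 ⟨fun i => y i + if i = ![a, b] then δ else 0, ?_, ?_, ?_⟩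
  · refine (mem_dualPolytope_matRE_iff v _).2 ⟨fun a' b' c' d' hab hcd => ?_, fun i => ?_⟩
    · have h0 := hc a' b' c' d' hab hcd
      by_cases h1 : ![a', d'] = ![a, b]
      · have e1 : a' = a := congrFun h1 0
        have e2 : d' = b := congrFun h1 1
        subst e1 e2
        have := hslack c' b' hab hcd
        simp only [if_true]
        split_ifs <;> linarith
      · by_cases h2 : ![c', b'] = ![a, b]
        · have e1 : c' = a := congrFun h2 0
          have e2 : b' = b := congrFun h2 1
          subst e1 e2
          have := hslack a' d' hcd hab
          simp only [h1, if_true, if_false]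
          linarith
        · simpa [h1, h2] using h0
    · have := abs_le.1 (hb i)
      by_cases hi : i = ![a, b]
      · subst hi
        simp only [if_true]
        exact abs_le.2 ⟨by linarith, by linarith⟩
      · simpa [hi] using hb i
  · intro h
    have := congrFun h ![a, b]
    simp only [if_true] at this
    linarith
  · intro i
    dsimp only
    split_ifs <;> linarith

/-- If `y ![a, b] + y ![b, a] < 0`, both coordinates are below `1` and have tight partners. By
transitivity the partners also form a constrained pair, whose sum is the negative of this one: a
contradiction. -/
theorem rank_eq_zero_of_isUndominated_matRE {v : Fin 2 → Fin D → ℝ}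
    {y : (Fin 2 → Fin D) → ℝ} (hy : IsUndominated (dualPolytope (matA v) (matRE v)) y) :
    rank y = 0 := by
  obtain ⟨hc, hb⟩ := (mem_dualPolytope_matRE_iff v y).1 hy.1
  refine rank_eq_zero_of_add_eq_zero fun a b => ?_
  by_contra hne
  have hlt := lt_of_le_of_ne (add_swap_nonpos_of_mem_matRE hy.1 a b) hne
  have h1 := abs_le.1 (hb ![a, b])
  have h2 := abs_le.1 (hb ![b, a])
  obtain ⟨c, d, had, hcb, e1⟩ := exists_tight_of_isUndominated_matRE hy a b (by linarith)
  obtain ⟨c', d', hbd, hca, e2⟩ := exists_tight_of_isUndominated_matRE hy b a (by linarith)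
  have := hc c d' c' d (patches_trans hcb hbd) (patches_trans hca had)
  linarith

theorem rank_eq_zero_of_isUndominated_matRS {v : Fin 2 → Fin D → ℝ}
    {y : (Fin 2 → Fin D) → ℝ} (hy : IsUndominated (dualPolytope (matA v) (matRS v)) y) :
    rank y = 0 := by
  obtain ⟨⟨p, q, hpq, hle⟩, hb⟩ := (mem_dualPolytope_matRS_iff v y).1 hy.1
  -- A monotone potential between `p` and `q` gives an antisymmetric point above `y`.
  have hmin : ∀ a, ∃ b, ![a, b] ∈ patches v ∧ ∀ c, ![a, c] ∈ patches v → q b ≤ q c := by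
    intro a
    obtain ⟨b, hb, h⟩ := Set.exists_min_image {b | ![a, b] ∈ patches v} q (Set.toFinite _)
      ⟨a, diag_mem_patches v a⟩
    exact ⟨b, hb, h⟩
  choose m hm hmle using hmin
  have hrq : ∀ a, q (m a) ≤ q a := fun a => hmle a a (diag_mem_patches v a)
  have hpr : ∀ a, p a ≤ q (m a) := fun a => hpq _ _ (hm a)
  have hyr : ∀ a b, y ![a, b] ≤ q (m a) - q (m b) := fun a b => by
    linarith [hle a b, hpr a, hrq b]
  have hmem : (fun i => q (m (i 0)) - q (m (i 1))) ∈ dualPolytope (matA v) (matRS v) := by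
    refine (mem_dualPolytope_matRS_iff v _).2 ⟨⟨fun a => q (m a), fun a => q (m a),
      fun a b hab => hmle a _ (patches_trans hab (hm b)), fun a b => le_rfl⟩, fun i => ?_⟩
    -- The new point dominates `y ≥ -1`; by antisymmetry this lower bound also gives the upper bound
    -- `1`.
    have h1 := hyr (i 0) (i 1)
    have h2 := hyr (i 1) (i 0)
    have h3 := abs_le.1 (hb ![i 0, i 1])
    have h4 := abs_le.1 (hb ![i 1, i 0])
    exact abs_le.2 ⟨by linarith, by linarith⟩
  have heq : (fun i => q (m (i 0)) - q (m (i 1))) = y := by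
    by_contra hne
    refine hy.2 ⟨_, hmem, hne, fun i => ?_⟩
    simpa only [eta_pair] using hyr (i 0) (i 1)
  rw [← heq]
  refine rank_eq_zero_of_add_eq_zero fun a b => ?_
  simp

theorem zero_mem_dualPolytope {m n l : Type*} [Fintype m] [Fintype l]
    (A : Matrix m n ℝ) (R : Matrix l n ℝ) : (0 : m → ℝ) ∈ dualPolytope A R :=
  ⟨⟨0, by simp⟩, by simp⟩

theorem isGreatest_rank_image {Q : Set ((Fin 2 → Fin D) → ℝ)} (h0 : 0 ∈ Q)
    (h : ∀ y ∈ Q, ∀ a b, y ![a, b] + y ![b, a] ≤ 0) : IsGreatest (rank '' Q) 0 := by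
  refine ⟨⟨0, h0, by simp [rank]⟩, ?_⟩
  rintro _ ⟨y, hy, rfl⟩
  exact rank_nonpos_of_add_nonpos (h y hy)

end StaticChoice

theorem mainTheorem7 (D : ℕ) (hD : 2 ≤ D) (k : ℕ)
    (x : Fin 2 → Fin D → (Fin k → ℝ)) (θ : Fin k → ℝ)
    (Q : Set ((Fin 2 → Fin D) → ℝ))
    (hQ : Q = StaticChoice.ddcpE x θ ∨ Q = StaticChoice.ddcpS x θ) :
    (∀ y ∈ Q.extremePoints ℝ, ∀ d, y d = 0 ∨ y d = 1 ∨ y d = -1) ∧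
    ∃ r : ℝ, IsGreatest (StaticChoice.rank '' Q) r ∧
      ∀ y ∈ Q.extremePoints ℝ, StaticChoice.IsUndominated Q y → StaticChoice.rank y = r := by
  rcases hQ with rfl | rfl
  · exact ⟨fun y hy => StaticChoice.integral_of_mem_extremePoints_matRE hy, 0,
      StaticChoice.isGreatest_rank_image (StaticChoice.zero_mem_dualPolytope _ _)
        fun y hy => StaticChoice.add_swap_nonpos_of_mem_matRE hy,
      fun y _ hy => StaticChoice.rank_eq_zero_of_isUndominated_matRE hy⟩
  · exact ⟨fun y hy => StaticChoice.integral_of_mem_extremePoints_matRS hy, 0,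
      StaticChoice.isGreatest_rank_image (StaticChoice.zero_mem_dualPolytope _ _)
        fun y hy => StaticChoice.add_swap_nonpos_of_mem_matRS hy,
      fun y _ hy => StaticChoice.rank_eq_zero_of_isUndominated_matRS hy⟩
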